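/- **Setting.** Fix a measurable context space $\mathcal X\subseteq\mathbb R^D$, measurable functions $\sigma^1,\sigma^2:\mathcal X\to(0,\infty)$, a probability density $\zeta$ on $\mathcal X$ (with respect to Lebesgue measure), and constants $C_Y,C_\mu,C_{\sigma^2}>0$ with $\max\{1/\sigma^a(x)^2,\sigma^a(x)^2\}\le C_{\sigma^2}$ for all $a\in\{1,2\}$, $x\in\mathcal X$. A two-armed bandit model $P$ is a joint law of $(Y^1,Y^2,X)$ with $Y^1,Y^2$ conditionally independent given $X$; write $\mu^a(P)=\mathbb E_P[Y^a]$ and $\mu^a(P)(x)=\mathbb E_P[Y^a\mid X=x]$. Let $\mathcal P_\infty$ be the set of all $P$ such that $X$ has density $\zeta$ and, for each arm $a$: (i) the law of $(Y^a,X)$ is mutually absolutely continuous with $\mathrm dy\otimes\zeta(x)\,\mathrm dx$ (as for Gaussian outcomes; in particular it has a Lebesgue density, and any two models are mutually absolutely continuous arm by arm); and, for $\zeta$-almost every $x$, (ii) $\mathrm{Var}_P(Y^a\mid X=x)=\sigma^a(x)^2$; (iii) $\mathbb E_P[\exp(\lambda(Y^a-\mu^a(P)(x)))\mid X=x]\le\exp(\lambda^2C_Y/2)$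 for all $\lambda\in\mathbb R$; (iv) $|\mu^a(P)(x)|\le C_\mu$. For $B\in\mathbb R$ let $\mathcal P_B$ be the set of $P\in\mathcal P_\infty$ that also satisfy the parallel-shift condition (v) $|\mu^1(P)(x)-\mu^2(P)(x)|\le B\,|\mu^1(P)-\mu^2(P)|$ for $\zeta$-almost every $x$. Let $\mathcal P^*$ be either $\mathcal P_\infty$, or $\mathcal P_B$ for a constant $B$ with $(\sigma^1(x)+\sigma^2(x))^2\le B\int(\sigma^1(z)+\sigma^2(z))^2\zeta(z)\,dz$ for $\zeta$-almost every $x$. Assume that $\mathcal P^*\neq\emptyset$. A strategy $\pi$ prescribes, for every budget $T$, a (possibly randomised) sampling rule that in each round $t\le T$ draws an arm $A_t$ on the basis of the past observations $(X_s,A_s,Y_s)_{s<t}$ and $X_t$, after which $Y_t=Y_t^{A_t}$ is observed (the $(Y^1_t,Y^2_t,X_t)$ being i.i.d. with law $P$), and a recommendation $\hat a_T$ that is a measurable function of the $T$ observations. It is null consistent if $|\mathbb P_P(\hat a_T=1)-\mathbb P_P(\hat a_T=2)|\to0$ as $T\to\infty$ for every $P\in\mathcal P^*$ with $\mu^1(P)=\mu^2(P)$.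 Its expected simple regret is $\mathbb E_P[r_T(\pi)]=\mathbb E_P[\max_a\mu^a(P)-\mu^{\hat a_T}(P)]$. **Theorem.** For every null consistent strategy $\pi$, $$\sup_{P\in\mathcal P^*}\sqrt T\,\mathbb E_P[r_T(\pi)]\ \ge\ \frac1{12}\sqrt{\int(\sigma^1(x)+\sigma^2(x))^2\zeta(x)\,dx}+o(1)\qquad(T\to\infty).$$ The constant is strictly larger than $\frac1{12}\sqrt{\sum_{a}\int\sigma^a(x)^2\zeta(x)\,dx}$, the constant of the general lower bound. Moreover, among all measurable allocations $w(1|x),w(2|x)>0$ with $w(1|x)+w(2|x)=1$, the quantity $\int\big(\frac{\sigma^1(x)^2}{w(1|x)}+\frac{\sigma^2(x)^2}{w(2|x)}\big)\zeta(x)\,dx$ is minimised, uniquely up to $\zeta$-null sets, by the Neyman ratio $w^*(a|x)=\sigma^a(x)/(\sigma^1(x)+\sigma^2(x))$, and its minimum is $\int(\sigma^1(x)+\sigma^2(x))^2\zeta(x)\,dx$. -/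

import Mathlib

open MeasureTheory ProbabilityTheory Filter Topology
open scoped ENNReal NNReal

noncomputable section

namespace BanditBAI

/-- The Euclidean space containing the contexts. For `D = 0` it is a point with the Dirac mass as
Lebesgue measure, which is the setting without contextual information. -/
abbrev Ctx (D : ℕ) : Type := EuclideanSpace ℝ (Fin D)

/-- Full data of one round: the context and the potential outcomes of all `K` arms. -/
abbrev FullData (K D : ℕ) : Type := Ctx D × (Fin K → ℝ)

/-- Observed data of one round: context, drawn arm, outcome of the drawn arm. -/
abbrev Obs (K D : ℕ) : Type := Ctx D × Fin K × ℝ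

/-- The observed data of `t` rounds. -/
abbrev Hist (K D t : ℕ) : Type := Fin t → Obs K D

/-! ### Bandit models -/

/-- A full-data bandit model: a joint distribution of the context and the potential outcomes. -/
abbrev Model (K D : ℕ) : Type := ProbabilityMeasure (FullData K D)

variable {K D : ℕ}

/-- The conditional distribution of the outcome of arm `a` given the context. -/
def outcomeLaw (P : Model K D) (a : Fin K) : Kernel (Ctx D) ℝ :=
  condDistrib (fun ω : FullData K D => ω.2 a) Prod.fst (P : Measure (FullData K D))

/-- The expected outcome of arm `a`. -/
def mean (P : Model K D) (a : Fin K) : ℝ :=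
  ∫ ω, ω.2 a ∂(P : Measure (FullData K D))

/-- The conditional expected outcome of arm `a` given the context `x`. -/
def condMean (P : Model K D) (a : Fin K) (x : Ctx D) : ℝ :=
  ∫ y, y ∂(outcomeLaw P a x)

/-- The data shared by all models of a location-shift class: the context space, the conditional
standard deviations, the context density, and the constants. -/
structure Setting (K D : ℕ) where
  /-- the context space -/
  X : Set (Ctx D)
  measurableSet_X : MeasurableSet X
  /-- the conditional standard deviations -/
  σ : Fin K → Ctx D → ℝ
  measurable_σ : ∀ a, Measurable (σ a)
  σ_pos : ∀ a, ∀ x ∈ X, 0 < σ a x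
  /-- the context density -/
  ζ : Ctx D → ℝ
  measurable_ζ : Measurable ζ
  ζ_nonneg : ∀ x ∈ X, 0 ≤ ζ x
  integral_ζ : ∫ x in X, ζ x = 1
  /-- the variance proxy -/
  CY : ℝ≥0
  CY_pos : 0 < CY
  /-- the bound on the conditional means -/
  Cμ : ℝ
  Cμ_pos : 0 < Cμ
  /-- the bound on the conditional variances and their inverses -/
  Cσ : ℝ
  Cσ_pos : 0 < Cσ
  σ_bound : ∀ a, ∀ x ∈ X, max (1 / σ a x ^ 2) (σ a x ^ 2) ≤ Cσ

/-- The distribution of the context. -/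
def Setting.ctxLaw (M : Setting K D) : Measure (Ctx D) :=
  (volume.restrict M.X).withDensity fun x => ENNReal.ofReal (M.ζ x)

/-- Membership in the location-shift class, except for the parallel shift condition. By
`outcome_ac` and `ac_outcome` the pair of context and outcome of an arm has a density with respect
to Lebesgue measure which is positive wherever the context density is, as for Gaussian outcomes;
in particular any two models of the class are mutually absolutely continuous arm by arm. -/
structure Setting.IsModel (M : Setting K D) (P : Model K D) : Prop where
  condIndep : iCondIndepFun (MeasurableSpace.comap Prod.fst inferInstance)
    measurable_fst.comap_le (fun (a : Fin K) (ω : FullData K D) => ω.2 a)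
    (P : Measure (FullData K D))
  map_fst : (P : Measure (FullData K D)).map Prod.fst = M.ctxLaw
  outcome_ac : ∀ a, (P : Measure (FullData K D)).map (fun ω => (ω.1, ω.2 a)) ≪
    M.ctxLaw.prod volume
  ac_outcome : ∀ a, M.ctxLaw.prod volume ≪
    (P : Measure (FullData K D)).map (fun ω => (ω.1, ω.2 a))
  variance_eq : ∀ a, ∀ᵐ x ∂M.ctxLaw, variance id (outcomeLaw P a x) = M.σ a x ^ 2
  subGaussian : ∀ a, ∀ᵐ x ∂M.ctxLaw,
    HasSubgaussianMGF (fun y => y - condMean P a x) M.CY (outcomeLaw P a x)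
  abs_condMean_le : ∀ a, ∀ᵐ x ∂M.ctxLaw, |condMean P a x| ≤ M.Cμ

/-- The location-shift class without the parallel shift condition. -/
def Setting.models (M : Setting K D) : Set (Model K D) := {P | M.IsModel P}

/-- The location-shift class with the parallel shift condition with constant `B`. -/
def Setting.parallelModels (M : Setting K D) (B : ℝ) : Set (Model K D) :=
  {P | M.IsModel P ∧ ∀ a b, ∀ᵐ x ∂M.ctxLaw,
    |condMean P a x - condMean P b x| ≤ B * |mean P a - mean P b|}

/-! ### Strategies -/

/-- A strategy: for every budget `T`, a (possibly randomised) sampling rule that draws the arm of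
the next round from the `t` past observations and the current context, and a recommendation that is
a function of all `T` observations. Only the rounds `t < T` of the rule for budget `T` are used. -/
structure Strategy (K D : ℕ) where
  sample : ℕ → (t : ℕ) → Kernel (Hist K D t × Ctx D) (Fin K)
  markov : ∀ T t, IsMarkovKernel (sample T t)
  recommend : (T : ℕ) → Hist K D T → Fin K
  measurable_recommend : ∀ T, Measurable (recommend T)

/-- One round: given the history, full data is drawn from `P` independently of the past, an arm is
drawn by `κ` from the history and the context only, and the outcome of that arm is revealed. -/
def roundKernel (P : Model K D) {t : ℕ} (κ : Kernel (Hist K D t × Ctx D) (Fin K)) :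
    Kernel (Hist K D t) (Obs K D) :=
  ((Kernel.const (Hist K D t) (P : Measure (FullData K D))) ⊗ₖ
    (κ.comap (fun p : Hist K D t × FullData K D => (p.1, p.2.1)) (by fun_prop))).map
    fun q : FullData K D × Fin K => (q.1.1, q.2, q.1.2 q.2)

/-- The law under `P` of the first `t` observations when arms are drawn by `κ`. -/
def histLaw (P : Model K D) (κ : (t : ℕ) → Kernel (Hist K D t × Ctx D) (Fin K)) :
    (t : ℕ) → Measure (Hist K D t)
  | 0 => Measure.dirac Fin.elim0
  | t + 1 => ((histLaw P κ t) ⊗ₘ (roundKernel P (κ t))).map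
      fun p : Hist K D t × Obs K D => (Fin.snoc p.1 p.2 : Hist K D (t + 1))

/-- The law under `P` of the experiment of budget `T`. -/
def Strategy.law (π : Strategy K D) (P : Model K D) (T : ℕ) : Measure (Hist K D T) :=
  histLaw P (π.sample T) T

lemma measurable_observe :
    Measurable fun q : FullData K D × Fin K => ((q.1.1, q.2, q.1.2 q.2) : Obs K D) := by
  refine Measurable.prodMk (by fun_prop) (Measurable.prodMk measurable_snd ?_)
  exact measurable_from_prod_countable_left fun a =>
    (measurable_pi_apply a).comp measurable_snd

lemma measurable_histSnoc (t : ℕ) :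
    Measurable fun p : Hist K D t × Obs K D => (Fin.snoc p.1 p.2 : Hist K D (t + 1)) := by
  refine measurable_pi_lambda _ fun i => ?_
  refine Fin.lastCases ?_ (fun j => ?_) i
  · simpa using measurable_snd
  · simp only [Fin.snoc_castSucc]
    exact (measurable_pi_apply j).comp measurable_fst

instance isMarkovKernel_roundKernel (P : Model K D) {t : ℕ}
    (κ : Kernel (Hist K D t × Ctx D) (Fin K)) [IsMarkovKernel κ] :
    IsMarkovKernel (roundKernel P κ) :=
  Kernel.IsMarkovKernel.map _ measurable_observe

lemma isProbabilityMeasure_histLaw (P : Model K D)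
    (κ : (t : ℕ) → Kernel (Hist K D t × Ctx D) (Fin K)) (hκ : ∀ t, IsMarkovKernel (κ t)) :
    ∀ t, IsProbabilityMeasure (histLaw P κ t)
  | 0 => by unfold histLaw; infer_instance
  | t + 1 => by
    have := isProbabilityMeasure_histLaw P κ hκ t
    have := hκ t
    unfold histLaw
    exact Measure.isProbabilityMeasure_map (measurable_histSnoc t).aemeasurable

instance (π : Strategy K D) (P : Model K D) (T : ℕ) : IsProbabilityMeasure (π.law P T) :=
  isProbabilityMeasure_histLaw P _ (π.markov T) T

/-- The probability under `P` that arm `a` is recommended with budget `T`. -/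
def Strategy.recProb (π : Strategy K D) (P : Model K D) (T : ℕ) (a : Fin K) : ℝ :=
  (π.law P T).real {h | π.recommend T h = a}

/-- The expected simple regret under `P` with budget `T`. -/
def Strategy.regret (π : Strategy K D) (P : Model K D) (T : ℕ) : ℝ :=
  ∫ h, ((⨆ a, mean P a) - mean P (π.recommend T h)) ∂(π.law P T)

/-- Null consistency over a class of models: whenever all arms have the same expected outcome, all
arms are recommended with asymptotically equal probability. -/
def Strategy.NullConsistent (π : Strategy K D) (C : Set (Model K D)) : Prop :=
  ∀ P ∈ C, (∀ a b, mean P a = mean P b) → ∀ a b,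
    Tendsto (fun T => |π.recProb P T a - π.recProb P T b|) atTop (𝓝 0)

/-! ### Allocations -/

/-- A context-dependent allocation ratio. -/
def Setting.IsAllocation (M : Setting K D) (w : Fin K → Ctx D → ℝ) : Prop :=
  (∀ a, Measurable (w a)) ∧ ∀ x ∈ M.X, (∀ a, 0 < w a x) ∧ ∑ a, w a x = 1

/-- The expectation over the context of the sum over the arms of `σ² / w`. -/
def Setting.allocVariance (M : Setting K D) (w : Fin K → Ctx D → ℝ) : ℝ≥0∞ :=
  ∫⁻ x, ENNReal.ofReal (∑ a, M.σ a x ^ 2 / w a x) ∂M.ctxLaw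

/-- The Neyman allocation. -/
def Setting.neyman (M : Setting K D) (a : Fin K) (x : Ctx D) : ℝ :=
  M.σ a x / ∑ b, M.σ b x

end BanditBAI

end

noncomputable section

namespace BanditBAI

variable {K D : ℕ}

/-! The lower bound is a two-point argument with Gaussian models whose likelihood ratio is
insensitive to the sampling rule. Put V = ∫ (σ⁰ + σ¹)² ζ and let the conditional mean of arm a be ±
d σᵃ (σ⁰ + σ¹) / V, with opposite signs for the two arms. The conditional gap is d (σ⁰ + σ¹)² / V,
with average d. Replacing d by -d moves the mean of arm a by 2d (σ⁰ + σ¹) / V standard deviations,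
whichever arm is drawn, so no adaptive rule can gain information by its choice of arms.

The likelihood ratio of a round then has second moment at most ∫ exp(4d² (σ⁰ + σ¹)² / V²) ζ ≤ 1 +
6d² / V for small d (`chiSqBound_shift`, `lintegral_exp_le`), and rounds multiply
(`chiSqBound_law`). For d = √V / (3√T) the product over T rounds is at most 9/4. By Cauchy–Schwarz
one of the two models then has probability at least 1/4 of a wrong recommendation
(`quarter_le_recProb_or`), hence regret at least d/4 = √V / (12√T).

The strict inequality comes from the cross term 2σ⁰σ¹ > 0, and the Neyman optimum from an identity
that exhibits the excess over (σ⁰ + σ¹)² as a square (`sum_div_eq_sq_add`). -/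

/-! ### Models with independent outcomes given the context -/

/-- The product of finitely many Markov kernels with the same source. -/
def piKernel (G : Fin K → Kernel (Ctx D) ℝ) [∀ a, IsMarkovKernel (G a)] :
    Kernel (Ctx D) (Fin K → ℝ) where
  toFun x := Measure.pi fun a => G a x
  measurable' := by
    refine Measurable.measure_of_isPiSystem_of_isProbabilityMeasure
      (S := Set.pi Set.univ '' Set.pi Set.univ fun _ : Fin K => {s : Set ℝ | MeasurableSet s})
      generateFrom_pi.symm isPiSystem_pi ?_
    rintro _ ⟨s, hs, rfl⟩
    simp only [Measure.pi_pi]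
    exact Finset.measurable_prod _ fun a _ => (G a).measurable_coe (hs a (Set.mem_univ a))

section Product

variable (ν : Measure (Ctx D)) [IsProbabilityMeasure ν] (G : Fin K → Kernel (Ctx D) ℝ)
  [∀ a, IsMarkovKernel (G a)]

lemma piKernel_apply (x : Ctx D) : piKernel G x = Measure.pi fun a => G a x := rfl

instance : IsMarkovKernel (piKernel G) :=
  ⟨fun x => by rw [piKernel_apply]; infer_instance⟩

/-- The model with context distribution `ν` whose outcomes are conditionally independent given the
context with conditional distributions `G`. -/
def productModel : Model K D := ⟨ν ⊗ₘ piKernel G, inferInstance⟩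

lemma coe_productModel : (productModel ν G : Measure (FullData K D)) = ν ⊗ₘ piKernel G := rfl

lemma map_fst_productModel :
    (productModel ν G : Measure (FullData K D)).map Prod.fst = ν := by
  rw [coe_productModel]
  exact Measure.fst_compProd ν (piKernel G)

lemma map_outcome_productModel (a : Fin K) :
    (productModel ν G : Measure (FullData K D)).map (fun ω => (ω.1, ω.2 a)) = ν ⊗ₘ G a := by
  have h : (piKernel G).map (fun y : Fin K → ℝ => y a) = G a := by
    ext1 x
    rw [Kernel.map_apply _ (measurable_pi_apply a), piKernel_apply]
    exact (measurePreserving_eval (fun a => G a x) a).map_eq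
  rw [coe_productModel, ← h, Measure.compProd_map (measurable_pi_apply a)]
  rfl

lemma outcomeLaw_productModel (a : Fin K) : outcomeLaw (productModel ν G) a =ᵐ[ν] G a := by
  have h := condDistrib_ae_eq_of_measure_eq_compProd (κ := G a)
    (μ := (productModel ν G : Measure (FullData K D))) (Prod.fst : FullData K D → Ctx D)
    (Y := fun ω : FullData K D => ω.2 a) (by fun_prop)
    (by rw [map_fst_productModel]; exact map_outcome_productModel ν G a)
  rwa [map_fst_productModel] at h

/-- Uniqueness of disintegration. It reduces conditional independence to the product formula for
`Measure.pi`. -/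
lemma condExp_outcomes_productModel {s : Set (Fin K → ℝ)} (hs : MeasurableSet s) :
    (productModel ν G : Measure (FullData K D))⟦Prod.snd ⁻¹' s |
      MeasurableSpace.comap Prod.fst inferInstance⟧
      =ᵐ[(productModel ν G : Measure (FullData K D))] fun ω => (piKernel G ω.1).real s := by
  have h := condDistrib_ae_eq_of_measure_eq_compProd (κ := piKernel G)
    (μ := (productModel ν G : Measure (FullData K D))) (Prod.fst : FullData K D → Ctx D)
    (Y := (Prod.snd : FullData K D → Fin K → ℝ)) (by fun_prop)
    (by rw [map_fst_productModel]; exact Measure.map_id)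
  refine (condDistrib_ae_eq_condExp measurable_fst measurable_snd hs).symm.trans ?_
  filter_upwards [ae_of_ae_map measurable_fst.aemeasurable h] with ω hω
  rw [hω]

lemma iCondIndepFun_productModel :
    iCondIndepFun (MeasurableSpace.comap Prod.fst inferInstance)
      measurable_fst.comap_le (fun (a : Fin K) (ω : FullData K D) => ω.2 a)
      (productModel ν G : Measure (FullData K D)) := by
  rw [iCondIndepFun_iff_condExp_inter_preimage_eq_mul _ _ (fun a => by fun_prop)]
  intro S s hs
  have hset : (⋂ a ∈ S, (fun ω : FullData K D => ω.2 a) ⁻¹' s a)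
      = Prod.snd ⁻¹' Set.pi (S : Set (Fin K)) s := by
    ext ω; simp [Set.mem_pi]
  rw [hset]
  have h1 := condExp_outcomes_productModel ν G
    (MeasurableSet.pi S.countable_toSet fun a ha => hs a ha)
  have h2 : ∀ a ∈ S, (productModel ν G : Measure (FullData K D))⟦
      (fun ω : FullData K D => ω.2 a) ⁻¹' s a | MeasurableSpace.comap Prod.fst inferInstance⟧
      =ᵐ[(productModel ν G : Measure (FullData K D))] fun ω => (G a ω.1).real (s a) := by
    intro a ha
    refine (condExp_outcomes_productModel ν G (measurable_pi_apply a (hs a ha))).trans ?_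
    refine ae_of_all _ fun ω => ?_
    simp only [Measure.real, piKernel_apply]
    rw [(measurePreserving_eval (fun a => G a ω.1) a).measure_preimage
      (hs a ha).nullMeasurableSet]
  have h3 := (Finset.eventually_all S).2 h2
  filter_upwards [h1, h3] with ω h1 h3
  rw [h1, Finset.prod_apply, Finset.prod_congr rfl h3]
  have hpi : Set.pi (S : Set (Fin K)) s
      = Set.pi Set.univ fun a => if a ∈ S then s a else Set.univ := by
    ext y
    simp only [Set.mem_pi, Finset.mem_coe, Set.mem_univ, forall_const]
    refine forall_congr' fun a => ?_
    by_cases ha : a ∈ S <;> simp [ha]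
  simp only [Measure.real, piKernel_apply]
  rw [hpi, Measure.pi_pi, ENNReal.toReal_prod, ← Finset.prod_subset S.subset_univ]
  · exact Finset.prod_congr rfl fun a ha => by simp [ha]
  · intro a _ ha
    simp [ha]

lemma mean_productModel (a : Fin K) (hint : Integrable (fun p : Ctx D × ℝ => p.2) (ν ⊗ₘ G a)) :
    mean (productModel ν G) a = ∫ x, ∫ y, y ∂(G a x) ∂ν := by
  have h : mean (productModel ν G) a = ∫ p, p.2 ∂(ν ⊗ₘ G a) := by
    rw [← map_outcome_productModel, integral_map (by fun_prop) (by fun_prop)]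
    rfl
  rw [h, Measure.integral_compProd hint]

end Product

/-! ### Second moment bounds for likelihood ratios -/

section ChiSq

variable {α β : Type*} [MeasurableSpace α] [MeasurableSpace β]

/-- Cauchy–Schwarz for √ρ and √G. `H` need not be measurable, which `ChiSqBound.compProd_right`
relies on. -/
lemma sq_lintegral_le_mul (μ : Measure α) {H ρ G : α → ℝ≥0∞} (hρ : Measurable ρ)
    (hG : Measurable G) (h : ∀ x, H x ^ 2 ≤ ρ x * G x) :
    (∫⁻ x, H x ∂μ) ^ 2 ≤ (∫⁻ x, ρ x ∂μ) * ∫⁻ x, G x ∂μ := by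
  have hsq : ∀ a : ℝ≥0∞, (a ^ (1 / 2 : ℝ)) ^ (2 : ℝ) = a := fun a => by
    rw [← ENNReal.rpow_mul]; norm_num
  have hle : ∫⁻ x, H x ∂μ ≤ ∫⁻ x, ((fun x => ρ x ^ (1 / 2 : ℝ)) * fun x => G x ^ (1 / 2 : ℝ)) x ∂μ := by
    refine lintegral_mono fun x => ?_
    rw [Pi.mul_apply, ← ENNReal.mul_rpow_of_nonneg _ _ (by norm_num),
      one_div, ENNReal.le_rpow_inv_iff (by norm_num)]
    exact_mod_cast h x
  have hcs := hle.trans (ENNReal.lintegral_mul_le_Lp_mul_Lq μ Real.HolderConjugate.two_two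
    (hρ.pow_const _).aemeasurable (hG.pow_const _).aemeasurable)
  simp only [hsq] at hcs
  rw [← ENNReal.mul_rpow_of_nonneg _ _ (by norm_num),
      one_div, ENNReal.le_rpow_inv_iff (by norm_num)] at hcs
  exact_mod_cast hcs

/-- The variational form of the statement that `μ` has a density with respect to `ν` whose second
moment under `ν` is at most `c`. -/
def ChiSqBound (μ ν : Measure α) (c : ℝ≥0∞) : Prop :=
  ∀ f : α → ℝ≥0∞, Measurable f → (∫⁻ x, f x ∂μ) ^ 2 ≤ c * ∫⁻ x, f x ^ 2 ∂ν

lemma ChiSqBound.map {μ ν : Measure α} {c : ℝ≥0∞} (h : ChiSqBound μ ν c) {g : α → β}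
    (hg : Measurable g) : ChiSqBound (μ.map g) (ν.map g) c := by
  intro f hf
  rw [lintegral_map hf hg, lintegral_map (hf.pow_const 2) hg]
  exact h _ (hf.comp hg)

/-- With a common first marginal, the fibrewise bounds combine by Cauchy–Schwarz with weight `ρ`, so
the constant is an average and not a supremum. -/
lemma ChiSqBound.compProd_right {μ : Measure α} [SFinite μ] {κ η : Kernel α β}
    [IsSFiniteKernel κ] [IsSFiniteKernel η] {ρ : α → ℝ≥0∞} (hρ : Measurable ρ)
    (h : ∀ᵐ x ∂μ, ChiSqBound (κ x) (η x) (ρ x)) :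
    ChiSqBound (μ ⊗ₘ κ) (μ ⊗ₘ η) (∫⁻ x, ρ x ∂μ) := by
  classical
  intro f hf
  rw [Measure.lintegral_compProd hf, Measure.lintegral_compProd (hf.pow_const 2)]
  -- The fibre integral is set to zero where the almost sure bound fails, so that the bound holds at
  -- every point.
  set p : α → Prop := fun x => (∫⁻ y, f (x, y) ∂κ x) ^ 2 ≤ ρ x * ∫⁻ y, f (x, y) ^ 2 ∂η x
  have hp : ∀ᵐ x ∂μ, p x := by
    filter_upwards [h] with x hx
    exact hx _ (hf.comp measurable_prodMk_left)
  have hH : ∫⁻ x, ∫⁻ y, f (x, y) ∂κ x ∂μ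
      = ∫⁻ x, (if p x then ∫⁻ y, f (x, y) ∂κ x else 0) ∂μ := by
    refine lintegral_congr_ae ?_
    filter_upwards [hp] with x hx
    rw [if_pos hx]
  rw [hH]
  refine sq_lintegral_le_mul μ hρ ((hf.pow_const 2).lintegral_kernel_prod_right') fun x => ?_
  by_cases hx : p x
  · rw [if_pos hx]; exact hx
  · rw [if_neg hx]; simp

/-- The fibre integral serves as test function for the base measures. The remaining integral is over
`ν`, so the fibre bound has to be uniform. -/
lemma ChiSqBound.compProd {μ ν : Measure α} [SFinite μ] [SFinite ν] {κ η : Kernel α β}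
    [IsSFiniteKernel κ] [IsSFiniteKernel η] {c r : ℝ≥0∞} (h : ChiSqBound μ ν c)
    (hr : ∀ x, ChiSqBound (κ x) (η x) r) :
    ChiSqBound (μ ⊗ₘ κ) (ν ⊗ₘ η) (c * r) := by
  intro f hf
  rw [Measure.lintegral_compProd hf, Measure.lintegral_compProd (hf.pow_const 2)]
  refine (h _ hf.lintegral_kernel_prod_right').trans ?_
  rw [mul_assoc, ← lintegral_const_mul _ ((hf.pow_const 2).lintegral_kernel_prod_right')]
  gcongr with x
  exact hr x _ (hf.comp measurable_prodMk_left)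

lemma chiSqBound_gaussianReal (m m' : ℝ) {v : ℝ≥0} (hv : v ≠ 0) :
    ChiSqBound (gaussianReal m v) (gaussianReal m' v)
      (ENNReal.ofReal (Real.exp ((m - m') ^ 2 / v))) := by
  intro f hf
  have hv' : (v : ℝ) ≠ 0 := by exact_mod_cast hv
  -- Completing the square: p_m² / p_{m'} is a constant times the Gaussian density with mean 2m -
  -- m', which integrates to one.
  have key : ∀ y, gaussianPDF m v y ^ 2 = ENNReal.ofReal (Real.exp ((m - m') ^ 2 / v)) *
      gaussianPDF (2 * m - m') v y * gaussianPDF m' v y := by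
    intro y
    simp only [gaussianPDF]
    rw [← ENNReal.ofReal_pow (gaussianPDFReal_nonneg _ _ _),
      ← ENNReal.ofReal_mul (Real.exp_pos _).le,
      ← ENNReal.ofReal_mul (mul_nonneg (Real.exp_pos _).le (gaussianPDFReal_nonneg _ _ _))]
    congr 1
    simp only [gaussianPDFReal]
    have : Real.exp (-(y - m) ^ 2 / (2 * v)) ^ 2 = Real.exp ((m - m') ^ 2 / v) *
        Real.exp (-(y - (2 * m - m')) ^ 2 / (2 * v)) * Real.exp (-(y - m') ^ 2 / (2 * v)) := by
      rw [← Real.exp_nat_mul, ← Real.exp_add, ← Real.exp_add]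
      congr 1
      field_simp
      push_cast
      ring
    linear_combination (√(2 * Real.pi * v))⁻¹ ^ 2 * this
  rw [gaussianReal_of_var_ne_zero _ hv, gaussianReal_of_var_ne_zero _ hv,
    lintegral_withDensity_eq_lintegral_mul _ (measurable_gaussianPDF _ _) hf,
    lintegral_withDensity_eq_lintegral_mul _ (measurable_gaussianPDF _ _) (hf.pow_const 2)]
  have h := sq_lintegral_le_mul volume
    (H := gaussianPDF m v * f)
    (ρ := fun y => ENNReal.ofReal (Real.exp ((m - m') ^ 2 / v)) * gaussianPDF (2 * m - m') v y)
    (G := gaussianPDF m' v * fun y => f y ^ 2)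
    ((measurable_gaussianPDF _ _).const_mul _)
    ((measurable_gaussianPDF _ _).mul (hf.pow_const 2)) fun y => by
      simp only [Pi.mul_apply]
      rw [mul_pow, key, mul_assoc]
  rwa [lintegral_const_mul _ (measurable_gaussianPDF _ _), lintegral_gaussianPDF_eq_one _ hv,
    mul_one] at h

end ChiSq

/-! ### Change of measure for experiments -/

section Experiment

/-- The conditional distribution of the observed outcome given the context and the drawn arm. -/
def armKernel (G : Fin K → Kernel (Ctx D) ℝ) : Kernel (Ctx D × Fin K) ℝ where
  toFun p := G p.2 p.1
  measurable' := measurable_from_prod_countable_left fun a => (G a).measurable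

lemma armKernel_apply (G : Fin K → Kernel (Ctx D) ℝ) (p : Ctx D × Fin K) :
    armKernel G p = G p.2 p.1 := rfl

instance (G : Fin K → Kernel (Ctx D) ℝ) [∀ a, IsMarkovKernel (G a)] :
    IsMarkovKernel (armKernel G) :=
  ⟨fun p => by rw [armKernel_apply]; infer_instance⟩

variable (ν : Measure (Ctx D)) [IsProbabilityMeasure ν]

/-- The arm is drawn from history and context alone, so the outcomes of the other arms integrate
out. What is left depends on the model only through the last factor. -/
lemma roundKernel_productModel (G : Fin K → Kernel (Ctx D) ℝ) [∀ a, IsMarkovKernel (G a)] {t : ℕ}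
    (κ : Kernel (Hist K D t × Ctx D) (Fin K)) [IsMarkovKernel κ] (h : Hist K D t) :
    roundKernel (productModel ν G) κ h
      = ((ν ⊗ₘ κ.comap (fun x => (h, x)) (by fun_prop)) ⊗ₘ armKernel G).map
        fun p : (Ctx D × Fin K) × ℝ => (p.1.1, p.1.2, p.2) := by
  refine Measure.ext_of_lintegral _ fun f hf => ?_
  have hg : Measurable fun p : (Ctx D × Fin K) × ℝ => f (p.1.1, p.1.2, p.2) := by fun_prop
  have hf' : Measurable fun q : FullData K D × Fin K => f (q.1.1, q.2, q.1.2 q.2) :=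
    hf.comp measurable_observe
  have hf'' : Measurable fun ω : FullData K D =>
      ∫⁻ a, f (ω.1, a, ω.2 a) ∂(κ.comap (fun ω : FullData K D => (h, ω.1)) (by fun_prop) ω) :=
    hf'.lintegral_kernel_prod_right'
  simp only [Kernel.comap_apply] at hf''
  rw [lintegral_map hf (by fun_prop), Measure.lintegral_compProd hg,
    Measure.lintegral_compProd hg.lintegral_kernel_prod_right', roundKernel,
    Kernel.map_apply _ measurable_observe, lintegral_map hf measurable_observe,
    Kernel.lintegral_compProd _ _ _ hf', Kernel.const_apply, coe_productModel]
  simp only [Kernel.comap_apply, armKernel_apply]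
  rw [Measure.lintegral_compProd hf'']
  refine lintegral_congr fun x => ?_
  dsimp only
  rw [lintegral_lintegral_swap ?_]
  · refine lintegral_congr fun a => ?_
    rw [piKernel_apply]
    exact (measurePreserving_eval (fun a => G a x) a).lintegral_comp
      (f := fun y => f (x, a, y)) (by fun_prop)
  · have : Measurable fun p : (Fin K → ℝ) × Fin K => f (x, p.2, p.1 p.2) :=
      hf'.comp (f := fun p : (Fin K → ℝ) × Fin K => (((x, p.1), p.2) : FullData K D × Fin K))
        (by fun_prop)
    exact this.aemeasurable

variable {G G' : Fin K → Kernel (Ctx D) ℝ} [∀ a, IsMarkovKernel (G a)]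
  [∀ a, IsMarkovKernel (G' a)] {ρ : Ctx D → ℝ≥0∞}

/-- Context and arm have the same joint law under both models. Since `ρ` depends on the context
only, its integral does not see `κ`. -/
lemma chiSqBound_roundKernel (hρ : Measurable ρ)
    (hG : ∀ a, ∀ᵐ x ∂ν, ChiSqBound (G a x) (G' a x) (ρ x)) {t : ℕ}
    (κ : Kernel (Hist K D t × Ctx D) (Fin K)) [IsMarkovKernel κ] (h : Hist K D t) :
    ChiSqBound (roundKernel (productModel ν G) κ h) (roundKernel (productModel ν G') κ h)
      (∫⁻ x, ρ x ∂ν) := by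
  have hint : ∫⁻ p, ρ p.1 ∂(ν ⊗ₘ κ.comap (fun x => (h, x)) (by fun_prop)) = ∫⁻ x, ρ x ∂ν := by
    rw [Measure.lintegral_compProd (by fun_prop)]
    simp
  rw [roundKernel_productModel, roundKernel_productModel, ← hint]
  refine (ChiSqBound.compProd_right (by fun_prop) ?_).map (by fun_prop)
  have hfst : ∀ᵐ p ∂(ν ⊗ₘ κ.comap (fun x => (h, x)) (by fun_prop)),
      ∀ a, ChiSqBound (G a p.1) (G' a p.1) (ρ p.1) := by
    refine ae_of_ae_map (p := fun x => ∀ a, ChiSqBound (G a x) (G' a x) (ρ x))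
      measurable_fst.aemeasurable ?_
    have : (ν ⊗ₘ κ.comap (fun x => (h, x)) (by fun_prop)).map Prod.fst = ν :=
      Measure.fst_compProd _ _
    rw [this]
    exact ae_all_iff.2 hG
  filter_upwards [hfst] with p hp using hp p.2

lemma chiSqBound_law (hρ : Measurable ρ)
    (hG : ∀ a, ∀ᵐ x ∂ν, ChiSqBound (G a x) (G' a x) (ρ x)) (π : Strategy K D) (T : ℕ) :
    ChiSqBound (π.law (productModel ν G) T) (π.law (productModel ν G') T)
      ((∫⁻ x, ρ x ∂ν) ^ T) := by
  suffices h : ∀ t, ChiSqBound (histLaw (productModel ν G) (π.sample T) t)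
      (histLaw (productModel ν G') (π.sample T) t) ((∫⁻ x, ρ x ∂ν) ^ t) from h T
  intro t
  induction t with
  | zero =>
    intro f hf
    simp [histLaw, lintegral_dirac' _ hf, lintegral_dirac' _ (hf.pow_const 2)]
  | succ t ih =>
    have := isProbabilityMeasure_histLaw (productModel ν G) (π.sample T) (π.markov T) t
    have := isProbabilityMeasure_histLaw (productModel ν G') (π.sample T) (π.markov T) t
    have := π.markov T t
    rw [pow_succ]
    exact (ih.compProd fun h => chiSqBound_roundKernel ν hρ hG (π.sample T t) h).map
      (measurable_histSnoc t)

end Experiment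

/-! ### Gaussian models -/

/-! ### Sub-Gaussian variables and their variance -/

section Analysis

/-- The right side is 2 + 4 sinh²(x/2), and |sinh u| ≥ |u|. -/
lemma two_add_sq_le_exp_add_exp_neg (x : ℝ) : 2 + x ^ 2 ≤ Real.exp x + Real.exp (-x) := by
  have h1 : Real.exp x + Real.exp (-x) = 2 * Real.cosh x := by rw [Real.cosh_eq]; ring
  have h2 : Real.cosh x = 1 + 2 * Real.sinh (x / 2) ^ 2 := by
    have := Real.cosh_two_mul (x / 2)
    rw [mul_div_cancel₀ x two_ne_zero, Real.cosh_sq] at this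
    linarith
  have h3 : (x / 2) ^ 2 ≤ Real.sinh (x / 2) ^ 2 := by
    rw [sq_le_sq, Real.abs_sinh, Real.self_le_sinh_iff]
    exact abs_nonneg _
  nlinarith

/-- Adding the moment bounds at l and -l cancels the odd part; comparing the terms of order l² as l
→ 0 gives the claim. -/
lemma integral_sq_le_of_hasSubgaussianMGF {Ω : Type*} [MeasurableSpace Ω] {μ : Measure Ω}
    [IsProbabilityMeasure μ] {Z : Ω → ℝ} {c : ℝ≥0} (h : HasSubgaussianMGF Z c μ) :
    ∫ ω, Z ω ^ 2 ∂μ ≤ c := by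
  set s := ∫ ω, Z ω ^ 2 ∂μ
  have hsq : Integrable (fun ω => Z ω ^ 2) μ := (h.memLp 2).integrable_sq
  have hexp : ∀ l : ℝ, 2 + l ^ 2 * s ≤ 2 * Real.exp (c * l ^ 2 / 2) := by
    intro l
    have h1 : ∫ ω, (2 + l ^ 2 * Z ω ^ 2) ∂μ
        ≤ ∫ ω, (Real.exp (l * Z ω) + Real.exp (-l * Z ω)) ∂μ := by
      refine integral_mono ((integrable_const _).add (hsq.const_mul _))
        ((h.integrable_exp_mul l).add (h.integrable_exp_mul (-l))) fun ω => ?_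
      have := two_add_sq_le_exp_add_exp_neg (l * Z ω)
      rwa [mul_pow, ← neg_mul] at this
    rw [integral_add (integrable_const _) (hsq.const_mul _), integral_const_mul,
      integral_add (h.integrable_exp_mul l) (h.integrable_exp_mul (-l))] at h1
    have h2 := h.mgf_le l
    have h3 := h.mgf_le (-l)
    rw [neg_sq] at h3
    simp only [mgf, integral_const, probReal_univ, one_smul] at h1 h2 h3
    linarith
  have hlim : Tendsto (fun l : ℝ => c + c ^ 2 * l ^ 2 / 2) (𝓝[>] 0) (𝓝 (c : ℝ)) := by
    have : Tendsto (fun l : ℝ => c + c ^ 2 * l ^ 2 / 2) (𝓝 0) (𝓝 ((c : ℝ) + c ^ 2 * 0 ^ 2 / 2)) :=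
      Continuous.tendsto (by fun_prop) 0
    simpa using this.mono_left nhdsWithin_le_nhds
  have hsmall : ∀ᶠ l : ℝ in 𝓝[>] 0, c * l ^ 2 / 2 ≤ 1 := by
    have : Tendsto (fun l : ℝ => (c : ℝ) * l ^ 2 / 2) (𝓝 0) (𝓝 ((c : ℝ) * 0 ^ 2 / 2)) :=
      Continuous.tendsto (by fun_prop) 0
    exact nhdsWithin_le_nhds (this.eventually_le_const (by norm_num))
  refine ge_of_tendsto hlim ?_
  filter_upwards [hsmall, self_mem_nhdsWithin] with l hl hl0
  have hl0 : 0 < l := hl0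
  have hnn : 0 ≤ c * l ^ 2 / 2 := by positivity
  -- exp u ≤ 1 + u + u² with u = c l² / 2.
  have h1 := (abs_le.1 (Real.abs_exp_sub_one_sub_id_le (by rwa [abs_of_nonneg hnn]))).2
  have h2 := hexp l
  have h3 : l ^ 2 * s ≤ l ^ 2 * (c + c ^ 2 * l ^ 2 / 2) := by nlinarith
  exact le_of_mul_le_mul_left h3 (by positivity)

lemma variance_id_le_of_hasSubgaussianMGF {μ : Measure ℝ} [IsProbabilityMeasure μ] {c : ℝ≥0}
    (h : HasSubgaussianMGF (fun y => y - ∫ z, z ∂μ) c μ) : variance id μ ≤ c := by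
  rw [variance_eq_integral measurable_id.aemeasurable]
  exact integral_sq_le_of_hasSubgaussianMGF h

lemma hasSubgaussianMGF_gaussianReal (m : ℝ) {v c : ℝ≥0} (hvc : v ≤ c) :
    HasSubgaussianMGF (fun y => y - m) c (gaussianReal m v) := by
  have hmap : (gaussianReal m v).map (fun y => y - m) = gaussianReal 0 v := by
    rw [gaussianReal_map_sub_const, sub_self]
  refine ⟨fun t => ?_, fun t => ?_⟩
  · have h := integrable_exp_mul_gaussianReal (μ := 0) (v := v) t
    rw [← hmap] at h
    exact h.comp_measurable (f := fun y => y - m) (by fun_prop)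
  · rw [mgf_gaussianReal hmap]
    have : (v : ℝ) ≤ c := by exact_mod_cast hvc
    gcongr
    nlinarith [sq_nonneg t]

end Analysis

/-- The kernel of normal distributions with given mean and standard deviation functions. -/
def gaussianKernel (m s : Ctx D → ℝ) (hm : Measurable m) (hs : Measurable s) :
    Kernel (Ctx D) ℝ where
  toFun x := gaussianReal (m x) (Real.toNNReal (s x ^ 2))
  measurable' := measurable_gaussianReal.comp (hm.prodMk (by fun_prop))

lemma gaussianKernel_apply (m s : Ctx D → ℝ) (hm : Measurable m) (hs : Measurable s) (x : Ctx D) :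
    gaussianKernel m s hm hs x = gaussianReal (m x) (Real.toNNReal (s x ^ 2)) := rfl

instance (m s : Ctx D → ℝ) (hm : Measurable m) (hs : Measurable s) :
    IsMarkovKernel (gaussianKernel m s hm hs) :=
  ⟨fun x => by rw [gaussianKernel_apply]; infer_instance⟩

lemma integrable_snd_compProd_gaussianKernel (ν : Measure (Ctx D)) [IsProbabilityMeasure ν]
    {m s : Ctx D → ℝ} (hm : Measurable m) (hs : Measurable s) {c d : ℝ}
    (hmc : ∀ᵐ x ∂ν, |m x| ≤ c) (hsd : ∀ᵐ x ∂ν, s x ^ 2 ≤ d) :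
    Integrable (fun p : Ctx D × ℝ => p.2) (ν ⊗ₘ gaussianKernel m s hm hs) := by
  rw [Measure.integrable_compProd_iff (by fun_prop)]
  have hid : ∀ x, MemLp id 2 (gaussianReal (m x) (Real.toNNReal (s x ^ 2))) :=
    fun x => memLp_id_gaussianReal 2
  refine ⟨ae_of_all _ fun x => (hid x).integrable one_le_two, ?_⟩
  -- The bound is |y| ≤ 1 + y² together with E Y² = s² + m².
  refine Integrable.of_bound (C := 1 + d + c ^ 2) ?_ ?_
  · exact (StronglyMeasurable.integral_kernel_prod_right'
      (f := fun p : Ctx D × ℝ => ‖p.2‖) (by fun_prop)).aestronglyMeasurable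
  · filter_upwards [hmc, hsd] with x hx hx'
    rw [Real.norm_of_nonneg (integral_nonneg fun y => norm_nonneg _), gaussianKernel_apply]
    have hsq := variance_eq_sub (hid x)
    rw [variance_id_gaussianReal, Real.coe_toNNReal _ (sq_nonneg _)] at hsq
    simp only [id_eq, integral_id_gaussianReal, Pi.pow_apply] at hsq
    have hi : Integrable (fun y : ℝ => y ^ 2) (gaussianReal (m x) (Real.toNNReal (s x ^ 2))) :=
      (hid x).integrable_sq
    have hle : ∫ y, ‖y‖ ∂(gaussianReal (m x) (Real.toNNReal (s x ^ 2)))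
        ≤ ∫ y, (1 + y ^ 2) ∂(gaussianReal (m x) (Real.toNNReal (s x ^ 2))) := by
      refine integral_mono ((hid x).integrable one_le_two).norm ((integrable_const _).add hi)
        fun y => ?_
      change |y| ≤ 1 + y ^ 2
      nlinarith [sq_abs y, sq_nonneg (|y| - 1), abs_nonneg y]
    rw [integral_add (integrable_const _) hi] at hle
    simp only [integral_const, probReal_univ, one_smul] at hle
    have : m x ^ 2 ≤ c ^ 2 := sq_le_sq' (abs_le.1 hx).1 (abs_le.1 hx).2
    linarith

/-! ### The context distribution -/

namespace Setting

variable (M : Setting K D)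

lemma ae_mem_X : ∀ᵐ x ∂M.ctxLaw, x ∈ M.X :=
  (withDensity_absolutelyContinuous _ _).ae_le (ae_restrict_mem M.measurableSet_X)

lemma integral_ctxLaw (f : Ctx D → ℝ) : ∫ x, f x ∂M.ctxLaw = ∫ x in M.X, f x * M.ζ x := by
  rw [ctxLaw, integral_withDensity_eq_integral_toReal_smul M.measurable_ζ.ennreal_ofReal
    (ae_of_all _ fun _ => ENNReal.ofReal_lt_top)]
  refine setIntegral_congr_fun M.measurableSet_X fun x hx => ?_
  simp [ENNReal.toReal_ofReal (M.ζ_nonneg x hx), mul_comm]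

instance isProbabilityMeasure_ctxLaw : IsProbabilityMeasure M.ctxLaw := by
  refine ⟨?_⟩
  rw [ctxLaw, withDensity_apply _ MeasurableSet.univ, Measure.restrict_univ,
    ← ofReal_integral_eq_lintegral_ofReal, M.integral_ζ, ENNReal.ofReal_one]
  -- Were `ζ` not integrable, its integral would be the default value 0 instead of 1.
  · by_contra h
    have := M.integral_ζ
    rw [integral_undef h] at this
    exact zero_ne_one this
  · exact (ae_restrict_iff' M.measurableSet_X).2 (ae_of_all _ M.ζ_nonneg)

lemma ae_σ_pos : ∀ᵐ x ∂M.ctxLaw, ∀ a, 0 < M.σ a x := by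
  filter_upwards [M.ae_mem_X] with x hx a using M.σ_pos a x hx

lemma ae_sq_σ_le : ∀ᵐ x ∂M.ctxLaw, ∀ a, M.σ a x ^ 2 ≤ M.Cσ := by
  filter_upwards [M.ae_mem_X] with x hx a using (le_max_right _ _).trans (M.σ_bound a x hx)

variable {M}

/-- A setting does not relate `σ` to `CY`; the existence of one model does. This puts Gaussian
models with variances σ² into the class. -/
lemma IsModel.ae_sq_σ_le_CY {P : Model K D} (h : M.IsModel P) (a : Fin K) :
    ∀ᵐ x ∂M.ctxLaw, M.σ a x ^ 2 ≤ M.CY := by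
  filter_upwards [h.variance_eq a, h.subGaussian a] with x h1 h2
  have : IsProbabilityMeasure (outcomeLaw P a x) := by unfold outcomeLaw; infer_instance
  rw [← h1]
  exact variance_id_le_of_hasSubgaussianMGF h2

variable (M)

/-- The Gaussian model with conditional means `m` and the standard deviations of the setting. -/
def gaussianModel (m : Fin K → Ctx D → ℝ) (hm : ∀ a, Measurable (m a)) : Model K D :=
  productModel M.ctxLaw fun a => gaussianKernel (m a) (M.σ a) (hm a) (M.measurable_σ a)

variable {m : Fin K → Ctx D → ℝ} (hm : ∀ a, Measurable (m a))

lemma outcomeLaw_gaussianModel (a : Fin K) : ∀ᵐ x ∂M.ctxLaw,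
    outcomeLaw (M.gaussianModel m hm) a x
      = gaussianReal (m a x) (Real.toNNReal (M.σ a x ^ 2)) :=
  outcomeLaw_productModel M.ctxLaw
    (fun a => gaussianKernel (m a) (M.σ a) (hm a) (M.measurable_σ a)) a

lemma condMean_gaussianModel (a : Fin K) :
    ∀ᵐ x ∂M.ctxLaw, condMean (M.gaussianModel m hm) a x = m a x := by
  filter_upwards [M.outcomeLaw_gaussianModel hm a] with x hx
  rw [condMean, hx, integral_id_gaussianReal]

lemma mean_gaussianModel (a : Fin K) {c : ℝ} (hmc : ∀ᵐ x ∂M.ctxLaw, |m a x| ≤ c) :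
    mean (M.gaussianModel m hm) a = ∫ x, m a x ∂M.ctxLaw := by
  rw [gaussianModel, mean_productModel]
  · simp [gaussianKernel_apply, integral_id_gaussianReal]
  · refine integrable_snd_compProd_gaussianKernel _ _ _ hmc (d := M.Cσ) ?_
    filter_upwards [M.ae_sq_σ_le] with x hx using hx a

lemma isModel_gaussianModel (hσ : ∀ a, ∀ᵐ x ∂M.ctxLaw, M.σ a x ^ 2 ≤ M.CY)
    (hmc : ∀ a, ∀ᵐ x ∂M.ctxLaw, |m a x| ≤ M.Cμ) : M.IsModel (M.gaussianModel m hm) where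
  condIndep := iCondIndepFun_productModel _ _
  map_fst := map_fst_productModel _ _
  outcome_ac a := by
    rw [gaussianModel, map_outcome_productModel, ← Measure.compProd_const]
    refine Measure.AbsolutelyContinuous.compProd_right ?_
    filter_upwards [M.ae_σ_pos] with x hx
    refine gaussianReal_absolutelyContinuous _ ?_
    simpa using (hx a).ne'
  ac_outcome a := by
    rw [gaussianModel, map_outcome_productModel, ← Measure.compProd_const]
    refine Measure.AbsolutelyContinuous.compProd_right ?_
    filter_upwards [M.ae_σ_pos] with x hx
    refine gaussianReal_absolutelyContinuous' _ ?_
    simpa using (hx a).ne'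
  variance_eq a := by
    filter_upwards [M.outcomeLaw_gaussianModel hm a] with x hx
    rw [hx, variance_id_gaussianReal, Real.coe_toNNReal _ (sq_nonneg _)]
  subGaussian a := by
    filter_upwards [M.outcomeLaw_gaussianModel hm a, M.condMean_gaussianModel hm a, hσ a]
      with x h1 h2 h3
    rw [h1, h2]
    exact hasSubgaussianMGF_gaussianReal _ (Real.toNNReal_le_iff_le_coe.2 h3)
  abs_condMean_le a := by
    filter_upwards [M.condMean_gaussianModel hm a, hmc a] with x h1 h2
    rwa [h1]

end Setting

/-! ### Two-armed bandits -/

namespace Strategy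

lemma regret_eq (π : Strategy 2 D) (P : Model 2 D) (T : ℕ) {a b : Fin 2} (hab : a ≠ b)
    (h : mean P b ≤ mean P a) :
    π.regret P T = (mean P a - mean P b) * π.recProb P T b := by
  have hcases : ∀ c : Fin 2, c = a ∨ c = b := by omega
  have hsup : ⨆ c, mean P c = mean P a := by
    refine le_antisymm (ciSup_le fun c => ?_) (le_ciSup (Set.finite_range _).bddAbove a)
    rcases hcases c with rfl | rfl
    exacts [le_rfl, h]
  have hint : (fun h => (⨆ c, mean P c) - mean P (π.recommend T h))
      = Set.indicator {h | π.recommend T h = b} fun _ => mean P a - mean P b := by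
    ext h
    rw [hsup]
    rcases hcases (π.recommend T h) with hc | hc
    · rw [Set.indicator_of_notMem (by simp [hc, hab]), hc, sub_self]
    · rw [Set.indicator_of_mem (by simp [hc]), hc]
  have hmeas : MeasurableSet {h | π.recommend T h = b} :=
    π.measurable_recommend T (measurableSet_singleton b)
  rw [regret, hint, integral_indicator_const _ hmeas, recProb, smul_eq_mul, mul_comm]

lemma regret_nonneg (π : Strategy 2 D) (P : Model 2 D) (T : ℕ) : 0 ≤ π.regret P T := by
  rcases le_total (mean P 0) (mean P 1) with h | h
  · rw [π.regret_eq P T one_ne_zero h]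
    exact mul_nonneg (sub_nonneg.2 h) measureReal_nonneg
  · rw [π.regret_eq P T zero_ne_one h]
    exact mul_nonneg (sub_nonneg.2 h) measureReal_nonneg

lemma recProb_zero_add_one (π : Strategy 2 D) (P : Model 2 D) (T : ℕ) :
    π.recProb P T 0 + π.recProb P T 1 = 1 := by
  have hcompl : {h | π.recommend T h = 1} = {h | π.recommend T h = 0}ᶜ := by
    ext h
    simp only [Set.mem_ofPred_eq, Set.mem_compl_iff]
    omega
  have hmeas : MeasurableSet {h | π.recommend T h = 0} :=
    π.measurable_recommend T (measurableSet_singleton 0)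
  rw [recProb, recProb, hcompl, measureReal_compl hmeas, probReal_univ]
  ring

/-- The test function is the indicator of the recommendation, which equals its square. -/
lemma sq_recProb_le (π : Strategy 2 D) {P Q : Model 2 D} {T : ℕ} {c : ℝ} (hc : 0 ≤ c)
    (h : ChiSqBound (π.law P T) (π.law Q T) (ENNReal.ofReal c)) (a : Fin 2) :
    π.recProb P T a ^ 2 ≤ c * π.recProb Q T a := by
  have hmeas : MeasurableSet {h | π.recommend T h = a} :=
    π.measurable_recommend T (measurableSet_singleton a)
  have h1 := h (Set.indicator {h | π.recommend T h = a} 1) (measurable_one.indicator hmeas)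
  have hsq : ∀ x, (Set.indicator {h | π.recommend T h = a} (1 : Hist 2 D T → ℝ≥0∞) x) ^ 2
      = Set.indicator {h | π.recommend T h = a} 1 x := by
    intro x
    by_cases hx : π.recommend T x = a <;> simp [hx]
  simp only [hsq, lintegral_indicator_one hmeas] at h1
  have h2 := ENNReal.toReal_mono (by finiteness) h1
  rwa [ENNReal.toReal_pow, ENNReal.toReal_mul, ENNReal.toReal_ofReal hc] at h2

/-- If both fail, arm 0 has probability above 3/4 under `P`, with square above 9/16, yet the square
is at most 9/4 times a number below 1/4. -/
lemma quarter_le_recProb_or (π : Strategy 2 D) {P Q : Model 2 D} {T : ℕ}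
    (h : ChiSqBound (π.law P T) (π.law Q T) (ENNReal.ofReal (9 / 4))) :
    1 / 4 ≤ π.recProb P T 1 ∨ 1 / 4 ≤ π.recProb Q T 0 := by
  by_contra! hlt
  have h1 := π.sq_recProb_le (by norm_num) h 0
  have h2 := π.recProb_zero_add_one P T
  nlinarith

end Strategy

/-! ### The constant of the bound -/

namespace Setting

variable (M : Setting 2 D)

/-- The variance of the Neyman allocation. -/
def sumSq : ℝ := ∫ x, (M.σ 0 x + M.σ 1 x) ^ 2 ∂M.ctxLaw

lemma measurable_sq_sum : Measurable fun x => (M.σ 0 x + M.σ 1 x) ^ 2 :=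
  ((M.measurable_σ 0).add (M.measurable_σ 1)).pow_const 2

lemma ae_sq_sum_le : ∀ᵐ x ∂M.ctxLaw, (M.σ 0 x + M.σ 1 x) ^ 2 ≤ 4 * M.Cσ := by
  filter_upwards [M.ae_sq_σ_le] with x hx
  nlinarith [hx 0, hx 1, sq_nonneg (M.σ 0 x - M.σ 1 x)]

lemma integrable_of_ae_abs_le {f : Ctx D → ℝ} (hf : Measurable f) {c : ℝ}
    (h : ∀ᵐ x ∂M.ctxLaw, |f x| ≤ c) : Integrable f M.ctxLaw :=
  Integrable.of_bound hf.aestronglyMeasurable c h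

lemma integrable_sq_sum : Integrable (fun x => (M.σ 0 x + M.σ 1 x) ^ 2) M.ctxLaw := by
  refine M.integrable_of_ae_abs_le M.measurable_sq_sum (c := 4 * M.Cσ) ?_
  filter_upwards [M.ae_sq_sum_le] with x hx
  rwa [abs_of_nonneg (sq_nonneg _)]

lemma integrable_sq_σ (a : Fin 2) : Integrable (fun x => M.σ a x ^ 2) M.ctxLaw := by
  refine M.integrable_of_ae_abs_le ((M.measurable_σ a).pow_const 2) (c := M.Cσ) ?_
  filter_upwards [M.ae_sq_σ_le] with x hx
  rw [abs_of_nonneg (sq_nonneg _)]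
  exact hx a

lemma sum_integral_sq_σ_lt_sumSq : ∑ a, ∫ x, M.σ a x ^ 2 ∂M.ctxLaw < M.sumSq := by
  have hi : Integrable (fun x => M.σ 0 x ^ 2 + M.σ 1 x ^ 2) M.ctxLaw :=
    (M.integrable_sq_σ 0).add (M.integrable_sq_σ 1)
  have hpos : ∀ᵐ x ∂M.ctxLaw, 0 < (M.σ 0 x + M.σ 1 x) ^ 2 - (M.σ 0 x ^ 2 + M.σ 1 x ^ 2) := by
    filter_upwards [M.ae_σ_pos] with x hx
    nlinarith [mul_pos (hx 0) (hx 1)]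
  have hnn := hpos.mono fun x hx => hx.le
  rw [sumSq, Fin.sum_univ_two, ← integral_add (M.integrable_sq_σ 0) (M.integrable_sq_σ 1),
    ← sub_pos, ← integral_sub M.integrable_sq_sum hi]
  refine (integral_nonneg_of_ae hnn).lt_of_ne fun h0 => ?_
  have h0 := (integral_eq_zero_iff_of_nonneg_ae hnn (M.integrable_sq_sum.sub hi)).1 h0.symm
  obtain ⟨x, hx, hx'⟩ := (hpos.and h0).exists
  exact hx.ne' hx'

lemma sumSq_pos : 0 < M.sumSq :=
  (Finset.sum_nonneg fun _ _ => integral_nonneg fun _ => sq_nonneg _).trans_lt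
    M.sum_integral_sq_σ_lt_sumSq

/-! ### The least favorable Gaussian models -/

/-- Conditional means with overall gap `d` for which the information about the gap in an outcome
does not depend on the drawn arm. -/
def shift (d : ℝ) (a : Fin 2) (x : Ctx D) : ℝ :=
  (if a = 0 then d else -d) * (M.σ a x * (M.σ 0 x + M.σ 1 x) / M.sumSq)

lemma measurable_shift (d : ℝ) (a : Fin 2) : Measurable (M.shift d a) :=
  (((M.measurable_σ a).mul ((M.measurable_σ 0).add (M.measurable_σ 1))).div_const _).const_mul _

lemma shift_sub (d : ℝ) (x : Ctx D) :
    M.shift d 0 x - M.shift d 1 x = d * ((M.σ 0 x + M.σ 1 x) ^ 2 / M.sumSq) := by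
  simp only [shift, if_true, one_ne_zero, if_false]
  ring

lemma ae_abs_shift_le (d : ℝ) (a : Fin 2) :
    ∀ᵐ x ∂M.ctxLaw, |M.shift d a x| ≤ |d| * (4 * M.Cσ / M.sumSq) := by
  filter_upwards [M.ae_σ_pos, M.ae_sq_sum_le] with x hx hx'
  have h0 := hx 0
  have h1 := hx 1
  have ha := hx a
  have hV := M.sumSq_pos
  have hle : M.σ a x ≤ M.σ 0 x + M.σ 1 x := by
    fin_cases a <;> simp <;> linarith
  have hd : |if a = 0 then d else -d| = |d| := by split_ifs <;> simp
  rw [shift, abs_mul, hd,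
    abs_of_nonneg (a := M.σ a x * (M.σ 0 x + M.σ 1 x) / M.sumSq) (by positivity)]
  have hprod : M.σ a x * (M.σ 0 x + M.σ 1 x) ≤ 4 * M.Cσ := by nlinarith
  gcongr

/-- The Gaussian model with conditional means `shift d`. -/
def shiftModel (d : ℝ) : Model 2 D := M.gaussianModel (M.shift d) (M.measurable_shift d)

lemma mean_shiftModel_sub (d : ℝ) :
    mean (M.shiftModel d) 0 - mean (M.shiftModel d) 1 = d := by
  have hi : ∀ a, Integrable (M.shift d a) M.ctxLaw := fun a =>
    M.integrable_of_ae_abs_le (M.measurable_shift d a) (M.ae_abs_shift_le d a)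
  rw [shiftModel, M.mean_gaussianModel _ 0 (M.ae_abs_shift_le d 0),
    M.mean_gaussianModel _ 1 (M.ae_abs_shift_le d 1), ← integral_sub (hi 0) (hi 1)]
  simp only [shift_sub, integral_const_mul, integral_div]
  rw [← sumSq, div_self M.sumSq_pos.ne', mul_one]

lemma isModel_shiftModel {d : ℝ} (hσ : ∀ a, ∀ᵐ x ∂M.ctxLaw, M.σ a x ^ 2 ≤ M.CY)
    (hd : |d| * (4 * M.Cσ / M.sumSq) ≤ M.Cμ) : M.IsModel (M.shiftModel d) := by
  refine M.isModel_gaussianModel _ hσ fun a => ?_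
  filter_upwards [M.ae_abs_shift_le d a] with x hx using hx.trans hd

/-- The ratio of conditional to overall gap is (σ⁰ + σ¹)² / V, so the parallel-shift condition is
exactly the assumption on `B`. -/
lemma ae_abs_condMean_shiftModel_sub (d : ℝ) {B : ℝ}
    (hB : ∀ᵐ x ∂M.ctxLaw, (M.σ 0 x + M.σ 1 x) ^ 2 ≤ B * M.sumSq) (a b : Fin 2) :
    ∀ᵐ x ∂M.ctxLaw, |condMean (M.shiftModel d) a x - condMean (M.shiftModel d) b x|
      ≤ B * |mean (M.shiftModel d) a - mean (M.shiftModel d) b| := by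
  have h01 : ∀ᵐ x ∂M.ctxLaw, |condMean (M.shiftModel d) 0 x - condMean (M.shiftModel d) 1 x|
      ≤ B * |mean (M.shiftModel d) 0 - mean (M.shiftModel d) 1| := by
    filter_upwards [hB, M.condMean_gaussianModel (M.measurable_shift d) 0,
      M.condMean_gaussianModel (M.measurable_shift d) 1] with x hx h0 h1
    rw [mean_shiftModel_sub, shiftModel, h0, h1, shift_sub, abs_mul, mul_comm,
      abs_of_nonneg (div_nonneg (sq_nonneg _) M.sumSq_pos.le)]
    gcongr
    rwa [div_le_iff₀ M.sumSq_pos]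
  fin_cases a <;> fin_cases b
  · simp
  · exact h01
  · filter_upwards [h01] with x hx
    simp only [Fin.mk_one, Fin.zero_eta]
    rwa [abs_sub_comm, abs_sub_comm (mean _ 1)]
  · simp

/-- The squared mean difference carries a factor σᵃ² that cancels the variance, so the exponent is
the same for both arms. -/
lemma chiSqBound_shift (d : ℝ) (a : Fin 2) : ∀ᵐ x ∂M.ctxLaw,
    ChiSqBound
      (gaussianKernel (M.shift d a) (M.σ a) (M.measurable_shift d a) (M.measurable_σ a) x)
      (gaussianKernel (M.shift (-d) a) (M.σ a) (M.measurable_shift (-d) a) (M.measurable_σ a) x)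
      (ENNReal.ofReal (Real.exp (4 * d ^ 2 * (M.σ 0 x + M.σ 1 x) ^ 2 / M.sumSq ^ 2))) := by
  filter_upwards [M.ae_σ_pos] with x hx
  have ha := hx a
  have hV := M.sumSq_pos
  have h := chiSqBound_gaussianReal (M.shift d a x) (M.shift (-d) a x)
    (v := Real.toNNReal (M.σ a x ^ 2)) (by simpa using ha.ne')
  rw [Real.coe_toNNReal _ (sq_nonneg _)] at h
  convert! h using 3
  simp only [shift]
  split_ifs
  · field_simp
    ring
  · field_simp
    ring

/-- On [0, 1/2], exp z ≤ 1 + z + z² ≤ 1 + 3z/2, and the exponent has integral 4d² / V. -/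
lemma lintegral_exp_le {d : ℝ} (hd : 4 * d ^ 2 * (4 * M.Cσ) / M.sumSq ^ 2 ≤ 1 / 2) :
    ∫⁻ x, ENNReal.ofReal (Real.exp (4 * d ^ 2 * (M.σ 0 x + M.σ 1 x) ^ 2 / M.sumSq ^ 2)) ∂M.ctxLaw
      ≤ ENNReal.ofReal (1 + 6 * d ^ 2 / M.sumSq) := by
  have hV := M.sumSq_pos
  have hi : Integrable (fun x => 1 + 6 * d ^ 2 / M.sumSq ^ 2 * (M.σ 0 x + M.σ 1 x) ^ 2) M.ctxLaw :=
    (integrable_const _).add (M.integrable_sq_sum.const_mul _)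
  have hint : ∫ x, (1 + 6 * d ^ 2 / M.sumSq ^ 2 * (M.σ 0 x + M.σ 1 x) ^ 2) ∂M.ctxLaw
      = 1 + 6 * d ^ 2 / M.sumSq := by
    rw [integral_add (integrable_const _) (M.integrable_sq_sum.const_mul _), integral_const_mul,
      ← sumSq]
    simp only [integral_const, probReal_univ, one_smul]
    field_simp
  rw [← hint, ofReal_integral_eq_lintegral_ofReal hi (ae_of_all _ fun x => by positivity)]
  refine lintegral_mono_ae ?_
  filter_upwards [M.ae_sq_sum_le] with x hx
  refine ENNReal.ofReal_le_ofReal ?_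
  set z := 4 * d ^ 2 * (M.σ 0 x + M.σ 1 x) ^ 2 / M.sumSq ^ 2 with hz
  have hz0 : 0 ≤ z := by positivity
  have hz1 : z ≤ 1 / 2 := le_trans (by rw [hz]; gcongr) hd
  have h1 := (abs_le.1 (Real.abs_exp_sub_one_sub_id_le
    (by rw [abs_of_nonneg hz0]; linarith))).2
  have h2 : 6 * d ^ 2 / M.sumSq ^ 2 * (M.σ 0 x + M.σ 1 x) ^ 2 = 3 / 2 * z := by
    rw [hz]; ring
  rw [h2]
  nlinarith

lemma one_add_div_pow_le (T : ℕ) (hT : 0 < T) : (1 + 2 / 3 / (T : ℝ)) ^ T ≤ 9 / 4 := by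
  have hT' : (0 : ℝ) < T := by exact_mod_cast hT
  have h1 : (1 + 2 / 3 / (T : ℝ)) ^ T ≤ Real.exp (2 / 3) := by
    calc (1 + 2 / 3 / (T : ℝ)) ^ T ≤ Real.exp (2 / 3 / T) ^ T := by
          gcongr
          rw [add_comm]
          exact Real.add_one_le_exp _
      _ = Real.exp (2 / 3) := by
          rw [← Real.exp_nat_mul]
          congr 1
          field_simp
  -- From exp(-1/3) ≥ 2/3.
  have h2 : Real.exp (1 / 3) ≤ 3 / 2 := by
    have h := Real.add_one_le_exp (-(1 / 3))
    rw [Real.exp_neg, le_inv_comm₀ (by norm_num) (Real.exp_pos _)] at h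
    exact h.trans (by norm_num)
  have h3 : Real.exp (2 / 3) = Real.exp (1 / 3) ^ 2 := by
    rw [← Real.exp_nat_mul]; norm_num
  rw [h3] at h1
  nlinarith [Real.exp_pos (1 / 3)]

lemma chiSqBound_law_shiftModel {d : ℝ} {T : ℕ} (hT : 0 < T)
    (hdT : d ^ 2 = M.sumSq / (9 * T))
    (hd : 4 * d ^ 2 * (4 * M.Cσ) / M.sumSq ^ 2 ≤ 1 / 2) (π : Strategy 2 D) :
    ChiSqBound (π.law (M.shiftModel d) T) (π.law (M.shiftModel (-d)) T)
      (ENNReal.ofReal (9 / 4)) := by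
  have hV := M.sumSq_pos
  have hT' : (0 : ℝ) < T := by exact_mod_cast hT
  have h := chiSqBound_law M.ctxLaw
    ((M.measurable_sq_sum.const_mul (4 * d ^ 2)).div_const _).exp.ennreal_ofReal
    (M.chiSqBound_shift d) π T
  intro f hf
  refine (h f hf).trans (mul_le_mul_left ?_ _)
  calc _ ≤ ENNReal.ofReal (1 + 6 * d ^ 2 / M.sumSq) ^ T := by
        gcongr
        exact M.lintegral_exp_le hd
    _ = ENNReal.ofReal ((1 + 2 / 3 / (T : ℝ)) ^ T) := by
        rw [ENNReal.ofReal_pow (by positivity)]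
        -- The value of d² makes 6d² / V equal to 2 / (3T).
        congr 3
        rw [hdT]
        field_simp
        norm_num
    _ ≤ _ := ENNReal.ofReal_le_ofReal (one_add_div_pow_le T hT)

/-- For every large budget, one of two Gaussian models of the class has a large simple regret. This
two-point bound holds for all strategies: the constant `1 / 12` does not need null consistency. -/
lemma exists_le_sqrt_mul_regret {C : Set (Model 2 D)}
    (hC : C = M.models ∨ ∃ B : ℝ, C = M.parallelModels B ∧
      ∀ᵐ x ∂M.ctxLaw, (M.σ 0 x + M.σ 1 x) ^ 2 ≤ B * M.sumSq)
    (hne : C.Nonempty) (π : Strategy 2 D) :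
    ∀ᶠ T : ℕ in atTop, ∃ P ∈ C, 1 / 12 * √M.sumSq ≤ √(T : ℝ) * π.regret P T := by
  have hV := M.sumSq_pos
  have hσ : ∀ a, ∀ᵐ x ∂M.ctxLaw, M.σ a x ^ 2 ≤ M.CY := by
    obtain ⟨P, hP⟩ := hne
    have : M.IsModel P := by
      rcases hC with rfl | ⟨B, rfl, -⟩
      exacts [hP, hP.1]
    exact fun a => this.ae_sq_σ_le_CY a
  have hmem : ∀ d, |d| * (4 * M.Cσ / M.sumSq) ≤ M.Cμ → M.shiftModel d ∈ C := by
    intro d hd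
    rcases hC with rfl | ⟨B, rfl, hB⟩
    · exact M.isModel_shiftModel hσ hd
    · exact ⟨M.isModel_shiftModel hσ hd, M.ae_abs_condMean_shiftModel_sub d hB⟩
  -- The half-gap scale √V / (3√T) vanishes, so eventually the means respect `Cμ` and the exponent
  -- stays below 1/2.
  have hlim : Tendsto (fun T : ℕ => √M.sumSq / (3 * √(T : ℝ))) atTop (𝓝 0) :=
    Tendsto.const_div_atTop ((Real.tendsto_sqrt_atTop.comp
      tendsto_natCast_atTop_atTop).const_mul_atTop three_pos) _
  have h1 : ∀ᶠ T : ℕ in atTop, |√M.sumSq / (3 * √(T : ℝ))| * (4 * M.Cσ / M.sumSq) ≤ M.Cμ := by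
    have := (hlim.abs.mul_const (4 * M.Cσ / M.sumSq))
    rw [abs_zero, zero_mul] at this
    exact this.eventually_le_const M.Cμ_pos
  have h2 : ∀ᶠ T : ℕ in atTop,
      4 * (√M.sumSq / (3 * √(T : ℝ))) ^ 2 * (4 * M.Cσ) / M.sumSq ^ 2 ≤ 1 / 2 := by
    have := (((hlim.pow 2).const_mul 4).mul_const (4 * M.Cσ)).div_const (M.sumSq ^ 2)
    simp only [ne_eq, OfNat.ofNat_ne_zero, not_false_eq_true, zero_pow, mul_zero, zero_mul,
      zero_div] at this
    exact this.eventually_le_const (by norm_num)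
  filter_upwards [h1, h2, eventually_gt_atTop 0] with T h1 h2 hT
  have hT' : (0 : ℝ) < T := by exact_mod_cast hT
  have hsT : 0 < √(T : ℝ) := Real.sqrt_pos.2 hT'
  set d := √M.sumSq / (3 * √(T : ℝ)) with hd
  have hd0 : 0 ≤ d := by positivity
  have hdT : d ^ 2 = M.sumSq / (9 * T) := by
    rw [hd, div_pow, mul_pow, Real.sq_sqrt hV.le, Real.sq_sqrt hT'.le]
    norm_num
  have hval : 1 / 12 * √M.sumSq = √(T : ℝ) * (d * (1 / 4)) := by
    rw [hd]
    field_simp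
    norm_num
  have hgap := M.mean_shiftModel_sub d
  have hgap' := M.mean_shiftModel_sub (-d)
  rcases π.quarter_le_recProb_or (M.chiSqBound_law_shiftModel hT hdT h2 π) with h | h
  · refine ⟨M.shiftModel d, hmem d h1, ?_⟩
    rw [π.regret_eq _ T zero_ne_one (by linarith), hgap, hval]
    gcongr
  · refine ⟨M.shiftModel (-d), hmem (-d) (by rwa [abs_neg]), ?_⟩
    have hgap'' : mean (M.shiftModel (-d)) 1 - mean (M.shiftModel (-d)) 0 = d := by linarith
    rw [π.regret_eq _ T one_ne_zero (by linarith), hgap'', hval]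
    gcongr

/-! ### The Neyman allocation -/

lemma isAllocation_neyman : M.IsAllocation M.neyman := by
  refine ⟨fun a => (M.measurable_σ a).div (Finset.measurable_sum _ fun b _ => M.measurable_σ b),
    fun x hx => ?_⟩
  have hs : 0 < ∑ b, M.σ b x := Finset.sum_pos (fun b _ => M.σ_pos b x hx) Finset.univ_nonempty
  refine ⟨fun a => div_pos (M.σ_pos a x hx) hs, ?_⟩
  simp only [neyman]
  rw [← Finset.sum_div, div_self hs.ne']

lemma allocVariance_neyman : M.allocVariance M.neyman = ENNReal.ofReal M.sumSq := by
  rw [sumSq, ofReal_integral_eq_lintegral_ofReal M.integrable_sq_sum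
    (ae_of_all _ fun x => sq_nonneg _), allocVariance]
  refine lintegral_congr_ae ?_
  filter_upwards [M.ae_σ_pos] with x hx
  have h0 := hx 0
  have h1 := hx 1
  congr 1
  simp only [neyman, Fin.sum_univ_two]
  field_simp

/-- The excess vanishes exactly when s w = t v, which is the Neyman ratio. -/
lemma sum_div_eq_sq_add {s t v w : ℝ} (hv : 0 < v) (hw : 0 < w) (hvw : v + w = 1) :
    s ^ 2 / v + t ^ 2 / w = (s + t) ^ 2 + (s * w - t * v) ^ 2 / (v * w) := by
  obtain rfl : w = 1 - v := by linarith
  field_simp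
  ring

lemma ae_sum_div_eq {w : Fin 2 → Ctx D → ℝ} (hw : M.IsAllocation w) : ∀ᵐ x ∂M.ctxLaw,
    ∑ a, M.σ a x ^ 2 / w a x = (M.σ 0 x + M.σ 1 x) ^ 2
      + (M.σ 0 x * w 1 x - M.σ 1 x * w 0 x) ^ 2 / (w 0 x * w 1 x) := by
  filter_upwards [M.ae_mem_X] with x hx
  obtain ⟨hpos, hsum⟩ := hw.2 x hx
  rw [Fin.sum_univ_two] at hsum ⊢
  exact sum_div_eq_sq_add (hpos 0) (hpos 1) hsum

lemma allocVariance_eq_add {w : Fin 2 → Ctx D → ℝ} (hw : M.IsAllocation w) :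
    M.allocVariance w = M.allocVariance M.neyman + ∫⁻ x, ENNReal.ofReal
      ((M.σ 0 x * w 1 x - M.σ 1 x * w 0 x) ^ 2 / (w 0 x * w 1 x)) ∂M.ctxLaw := by
  rw [allocVariance_neyman, sumSq, ofReal_integral_eq_lintegral_ofReal M.integrable_sq_sum
    (ae_of_all _ fun x => sq_nonneg _), ← lintegral_add_left M.measurable_sq_sum.ennreal_ofReal,
    allocVariance]
  refine lintegral_congr_ae ?_
  filter_upwards [M.ae_sum_div_eq hw, M.ae_mem_X] with x h hx
  have hpos := (hw.2 x hx).1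
  rw [h, ENNReal.ofReal_add (sq_nonneg _)
    (div_nonneg (sq_nonneg _) (mul_pos (hpos 0) (hpos 1)).le)]

lemma ae_eq_neyman_of_allocVariance_eq {w : Fin 2 → Ctx D → ℝ} (hw : M.IsAllocation w)
    (h : M.allocVariance w = M.allocVariance M.neyman) (a : Fin 2) :
    w a =ᵐ[M.ctxLaw] M.neyman a := by
  have hzero : ∫⁻ x, ENNReal.ofReal
      ((M.σ 0 x * w 1 x - M.σ 1 x * w 0 x) ^ 2 / (w 0 x * w 1 x)) ∂M.ctxLaw = 0 := by
    rw [M.allocVariance_eq_add hw, M.allocVariance_neyman] at h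
    -- Cancellation is allowed because the Neyman value is finite.
    exact (ENNReal.add_right_inj ENNReal.ofReal_ne_top).1 (h.trans (add_zero _).symm)
  have h0 := hw.1 0
  have h1 := hw.1 1
  have hs0 := M.measurable_σ 0
  have hs1 := M.measurable_σ 1
  rw [lintegral_eq_zero_iff (by fun_prop)] at hzero
  filter_upwards [hzero, M.ae_mem_X] with x hx hxX
  obtain ⟨hpos, hsum⟩ := hw.2 x hxX
  rw [Fin.sum_univ_two] at hsum
  have hw0 := hpos 0
  have hw1 := hpos 1
  have hσ0 := M.σ_pos 0 x hxX
  have hσ1 := M.σ_pos 1 x hxX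
  have hz : M.σ 0 x * w 1 x - M.σ 1 x * w 0 x = 0 := by
    have hle := ENNReal.ofReal_eq_zero.1 hx
    have hge : 0 ≤ (M.σ 0 x * w 1 x - M.σ 1 x * w 0 x) ^ 2 / (w 0 x * w 1 x) := by positivity
    have := le_antisymm hle hge
    rw [div_eq_zero_iff, or_iff_left (mul_pos hw0 hw1).ne'] at this
    exact pow_eq_zero_iff two_ne_zero |>.1 this
  have hw1' : w 1 x = 1 - w 0 x := by linarith
  rw [neyman, Fin.sum_univ_two, eq_div_iff (by positivity)]
  rw [hw1'] at hz
  fin_cases a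
  · simp only [Fin.zero_eta]
    linarith
  · simp only [Fin.mk_one, hw1']
    linarith

end Setting

end BanditBAI

end

/-! ### Assembly of the claims -/

theorem mainTheorem2 {D : ℕ} (M : BanditBAI.Setting 2 D)
    (C : Set (BanditBAI.Model 2 D))
    (hC : C = M.models ∨ ∃ B : ℝ, C = M.parallelModels B ∧
      ∀ᵐ x ∂M.ctxLaw, (M.σ 0 x + M.σ 1 x) ^ 2 ≤
        B * ∫ z in M.X, (M.σ 0 z + M.σ 1 z) ^ 2 * M.ζ z)
    (hne : C.Nonempty) :
    (∀ π : BanditBAI.Strategy 2 D, π.NullConsistent C →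
      ∃ e : ℕ → ℝ, Tendsto e atTop (𝓝 0) ∧ ∀ T : ℕ,
        ((1 / 12 * √(∫ x in M.X, (M.σ 0 x + M.σ 1 x) ^ 2 * M.ζ x) + e T : ℝ) : EReal) ≤
          ⨆ P ∈ C, ((√(T : ℝ) * π.regret P T : ℝ) : EReal)) ∧
    (1 / 12 * √(∑ a, ∫ x in M.X, M.σ a x ^ 2 * M.ζ x) <
      1 / 12 * √(∫ x in M.X, (M.σ 0 x + M.σ 1 x) ^ 2 * M.ζ x)) ∧
    (M.IsAllocation M.neyman ∧
      M.allocVariance M.neyman =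
        ENNReal.ofReal (∫ x in M.X, (M.σ 0 x + M.σ 1 x) ^ 2 * M.ζ x) ∧
      ∀ w, M.IsAllocation w → M.allocVariance M.neyman ≤ M.allocVariance w ∧
        (M.allocVariance w = M.allocVariance M.neyman →
          ∀ a, w a =ᵐ[M.ctxLaw] M.neyman a)) := by
  have hV : ∫ x in M.X, (M.σ 0 x + M.σ 1 x) ^ 2 * M.ζ x = M.sumSq :=
    (M.integral_ctxLaw _).symm
  have hσ : ∀ a, ∫ x in M.X, M.σ a x ^ 2 * M.ζ x = ∫ x, M.σ a x ^ 2 ∂M.ctxLaw :=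
    fun a => (M.integral_ctxLaw _).symm
  simp only [hV, hσ] at hC ⊢
  refine ⟨fun π _ => ?_, ?_, M.isAllocation_neyman, M.allocVariance_neyman, fun w hw => ⟨?_,
    M.ae_eq_neyman_of_allocVariance_eq hw⟩⟩
  · obtain ⟨T₀, hT₀⟩ := eventually_atTop.1 (M.exists_le_sqrt_mul_regret hC hne π)
    -- Before `T₀` the error cancels the constant, and the claim becomes nonnegativity of the regret
    -- at some model of the class.
    refine ⟨fun T => if T₀ ≤ T then 0 else -(1 / 12 * √M.sumSq), ?_, fun T => ?_⟩
    · refine tendsto_const_nhds.congr' ?_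
      filter_upwards [eventually_ge_atTop T₀] with T hT
      rw [if_pos hT]
    · by_cases hT : T₀ ≤ T
      · obtain ⟨P, hP, hle⟩ := hT₀ T hT
        simp only [if_pos hT, add_zero]
        exact le_iSup₂_of_le P hP (EReal.coe_le_coe_iff.2 hle)
      · obtain ⟨P, hP⟩ := hne
        simp only [if_neg hT, add_neg_cancel]
        exact le_iSup₂_of_le P hP (EReal.coe_le_coe_iff.2
          (mul_nonneg (Real.sqrt_nonneg _) (π.regret_nonneg P T)))
  · gcongr
    exact M.sum_integral_sq_σ_lt_sumSq
  · rw [M.allocVariance_eq_add hw]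
    exact le_self_add
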